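/- Let $R$ be an associative (unital, not necessarily commutative) ring; modules are left $R$-modules. A module $C$ is \emph{cotorsion} if $\operatorname{Ext}^1_R(F,C)=0$ for every flat module $F$, and \emph{flat-cotorsion} if it is both flat and cotorsion. A \emph{totally acyclic complex of flat-cotorsion modules} is an acyclic complex $T=(\cdots\to T_1\to T_0\to T_{-1}\to\cdots)$ of flat-cotorsion modules, indexed by $\mathbb{Z}$, such that the complexes $\operatorname{Hom}_R(T,W)$ and $\operatorname{Hom}_R(W,T)$ are acyclic for every flat-cotorsion module $W$. A module $G$ is \emph{Gorenstein flat-cotorsion} if $G\cong Z_0(T)=\ker(T_0\to T_{-1})$ for some totally acyclic complex $T$ of flat-cotorsion modules. \textbf{Proposition.} Let $0\to G'\to G\to G''\to 0$ be an exact sequence of cotorsion $R$-modules. (a) If $G''$ is Gorenstein flat-cotorsion, then $G$ is Gorenstein flat-cotorsion if and only if $G'$ is Gorenstein flat-cotorsion. (b) If $G'$ and $G$ are Gorenstein flat-cotorsion, then $G''$ is Gorenstein flat-cotorsion if and only if $\operatorname{Ext}^1_R(G'',W)=0$ holds for every flat-cotorsion $R$-module $W$. -/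

import Mathlib

open CategoryTheory CategoryTheory.Abelian
open scoped TensorProduct

universe u

namespace GorFlatCot

section Flat

variable (R : Type u) [Ring R]

/-- The subgroup of `A ⊗[ℤ] M` generated by the elements `(a r) ⊗ m - a ⊗ (r m)`, for a right
`R`-module `A` (a module over `Rᵐᵒᵖ`) and a left `R`-module `M`. -/
def balancedRel (A M : Type u) [AddCommGroup A] [Module Rᵐᵒᵖ A] [AddCommGroup M] [Module R M] :
    AddSubgroup (A ⊗[ℤ] M) :=
  AddSubgroup.closure
    {x | ∃ (a : A) (r : R) (m : M), x = (MulOpposite.op r • a) ⊗ₜ[ℤ] m - a ⊗ₜ[ℤ] (r • m)}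

/-- The tensor product `A ⊗_R M` of a right `R`-module `A` and a left `R`-module `M` over the
associative ring `R`: the abelian group `A ⊗[ℤ] M` modulo `(a r) ⊗ m = a ⊗ (r m)`. -/
abbrev BalancedTensor (A M : Type u) [AddCommGroup A] [Module Rᵐᵒᵖ A] [AddCommGroup M]
    [Module R M] : Type u :=
  (A ⊗[ℤ] M) ⧸ balancedRel R A M

variable {A B : Type u} [AddCommGroup A] [Module Rᵐᵒᵖ A] [AddCommGroup B] [Module Rᵐᵒᵖ B]

theorem balancedRel_le_comap (M : Type u) [AddCommGroup M] [Module R M] (f : A →ₗ[Rᵐᵒᵖ] B) :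
    balancedRel R A M ≤
      (balancedRel R B M).comap
        (f.toAddMonoidHom.toIntLinearMap.rTensor M).toAddMonoidHom := by
  refine (AddSubgroup.closure_le _).2 ?_
  rintro _ ⟨a, r, m, rfl⟩
  refine AddSubgroup.subset_closure ⟨f a, r, m, ?_⟩
  simp

/-- The homomorphism `f ⊗_R M : A ⊗_R M → B ⊗_R M` induced by a homomorphism `f : A → B` of
right `R`-modules. -/
def BalancedTensor.map (M : Type u) [AddCommGroup M] [Module R M] (f : A →ₗ[Rᵐᵒᵖ] B) :
    BalancedTensor R A M →+ BalancedTensor R B M :=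
  QuotientAddGroup.map _ _ (f.toAddMonoidHom.toIntLinearMap.rTensor M).toAddMonoidHom
    (balancedRel_le_comap R M f)

end Flat

variable {R : Type u} [Ring R]

/-- A left `R`-module `M` is flat if `- ⊗_R M` preserves injectivity of homomorphisms of right
`R`-modules. -/
def IsFlat (M : ModuleCat.{u} R) : Prop :=
  ∀ (A B : Type u) [AddCommGroup A] [Module Rᵐᵒᵖ A] [AddCommGroup B] [Module Rᵐᵒᵖ B]
    (f : A →ₗ[Rᵐᵒᵖ] B), Function.Injective f → Function.Injective (BalancedTensor.map R M f)

/-- `C` is cotorsion if `Ext¹(F, C) = 0` for every flat module `F`. -/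
def IsCotorsion (C : ModuleCat.{u} R) : Prop :=
  ∀ F : ModuleCat.{u} R, IsFlat F → Subsingleton (Ext F C 1)

/-- Modules that are both flat and cotorsion. -/
def IsFlatCotorsion (W : ModuleCat.{u} R) : Prop :=
  IsFlat W ∧ IsCotorsion W

/-- The complex of abelian groups `Hom_R(T, W)`, for a complex `T` and a module `W`. -/
noncomputable def homInto (T : ChainComplex (ModuleCat.{u} R) ℤ) (W : ModuleCat.{u} R) :
    HomologicalComplex AddCommGrpCat.{u} (ComplexShape.down ℤ).symm :=
  ((preadditiveYoneda.obj W).mapHomologicalComplex _).obj T.op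

/-- The complex of abelian groups `Hom_R(W, T)`, for a module `W` and a complex `T`. -/
noncomputable def homFrom (W : ModuleCat.{u} R) (T : ChainComplex (ModuleCat.{u} R) ℤ) :
    ChainComplex AddCommGrpCat.{u} ℤ :=
  ((preadditiveCoyoneda.obj (Opposite.op W)).mapHomologicalComplex _).obj T

/-- A totally acyclic complex of flat-cotorsion modules. -/
structure IsTotallyAcyclic (T : ChainComplex (ModuleCat.{u} R) ℤ) : Prop where
  flatCotorsion : ∀ n : ℤ, IsFlatCotorsion (T.X n)
  acyclic : T.Acyclic
  homInto_acyclic : ∀ W : ModuleCat.{u} R, IsFlatCotorsion W → (homInto T W).Acyclic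
  homFrom_acyclic : ∀ W : ModuleCat.{u} R, IsFlatCotorsion W → (homFrom W T).Acyclic

/-- `G` is Gorenstein flat-cotorsion if it is (isomorphic to) the module of cycles in degree `0`
of a totally acyclic complex of flat-cotorsion modules. -/
def IsGorensteinFlatCotorsion (G : ModuleCat.{u} R) : Prop :=
  ∃ T : ChainComplex (ModuleCat.{u} R) ℤ, IsTotallyAcyclic T ∧ Nonempty (T.cycles 0 ≅ G)

end GorFlatCot

/-!
Write `W` for the class of flat-cotorsion modules. All that matters about it is that it is closed
under finite direct sums and that `Ext¹(T, T') = 0` for `T` and `T'` in `W`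
(`isSelfOrthogonal_flatCotorsion`).

Being a cycle module of a totally acyclic complex can be described one step at a time:
`isGorensteinFlatCotorsion_iff` says that the Gorenstein flat-cotorsion modules form the largest
class `P` such that `Ext¹(G, T) = 0 = Ext¹(T, G)` for `G` in `P` and `T` in `W`, and such that each
`G` in `P` has short exact sequences `0 ⟶ K ⟶ T ⟶ G ⟶ 0` and `0 ⟶ G ⟶ T' ⟶ K' ⟶ 0` with `K`, `K'`
in `P` and `T`, `T'` in `W`. In one direction the class consists of the cycles of a totally
acyclic complex, in the other the short exact sequences are spliced. With this coinductive
description, a module is shown to be Gorenstein by exhibiting a class with these properties that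
contains it, and no complex has to be constructed. It also makes sense in any abelian category.

There, an extension of Gorenstein objects is Gorenstein by a horseshoe argument
(`IsGorenstein.of_isExtension`), and a direct summand of a Gorenstein object is Gorenstein if its
complement is in `W` (`IsGorenstein.of_biprod`). Now let `0 ⟶ A ⟶ B ⟶ D ⟶ 0` be exact.

* If `B` and `D` are Gorenstein, choose `0 ⟶ K ⟶ T ⟶ D ⟶ 0`. The pullback of `B` and `T` over `D`
  is an extension of `B` by `K`, hence Gorenstein, and an extension of `T` by `A`, hence isomorphic
  to `A ⊞ T` if `A` is cotorsion. So `A` is Gorenstein (`IsGorenstein.of_isExtension_left`).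
* If `A` and `B` are Gorenstein, choose `0 ⟶ A ⟶ T ⟶ K ⟶ 0`. The pushout of `B` and `T` under `A` is
  an extension of `K` by `B`, hence Gorenstein, and an extension of `D` by `T`, hence isomorphic to
  `T ⊞ D` if `Ext¹(D, T) = 0`. So `D` is Gorenstein (`IsGorenstein.of_isExtension_right`).
-/

namespace GorFlatCot

open Limits
open scoped ZeroObject

/-! ### Short exact sequences in an abelian category -/

section Abelian

universe v w
variable {C : Type w} [Category.{v} C] [Abelian C]

/-- `0 ⟶ A ⟶ B ⟶ D ⟶ 0` is a short exact sequence, as a property of its two morphisms. -/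
def IsShortExact {A B D : C} (i : A ⟶ B) (p : B ⟶ D) : Prop :=
  ∃ w : i ≫ p = 0, (ShortComplex.mk i p w).ShortExact

namespace IsShortExact

theorem mono {A B D : C} {i : A ⟶ B} {p : B ⟶ D} (h : IsShortExact i p) : Mono i :=
  h.2.mono_f

theorem epi {A B D : C} {i : A ⟶ B} {p : B ⟶ D} (h : IsShortExact i p) : Epi p :=
  h.2.epi_g

/-- An epimorphism, together with a monomorphism through which every morphism that it kills
factors. -/
theorem of_lift {A B D : C} {i : A ⟶ B} {p : B ⟶ D} [Mono i] [Epi p] (w : i ≫ p = 0)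
    (h : ∀ {X : C} (x : X ⟶ B), x ≫ p = 0 → ∃ y : X ⟶ A, y ≫ i = x) : IsShortExact i p := by
  choose l hl using @h
  refine ⟨w, ShortComplex.ShortExact.mk' ?_ ‹_› ‹_›⟩
  exact ShortComplex.exact_of_f_is_kernel _
    (KernelFork.IsLimit.ofι' i w fun x hx => ⟨l x hx, hl x hx⟩)

theorem exists_lift {A B D X : C} {i : A ⟶ B} {p : B ⟶ D} (h : IsShortExact i p) (x : X ⟶ B)
    (hx : x ≫ p = 0) : ∃ y : X ⟶ A, y ≫ i = x :=
  have := h.mono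
  ⟨h.2.exact.lift x hx, h.2.exact.lift_f x hx⟩

theorem comp_iso {A B D D' : C} {i : A ⟶ B} {p : B ⟶ D} (h : IsShortExact i p) (e : D ≅ D') :
    IsShortExact i (p ≫ e.hom) := by
  have := h.mono
  have := h.epi
  refine of_lift (by rw [reassoc_of% h.1, zero_comp]) fun x hx => h.exists_lift x ?_
  rwa [← Category.assoc, Preadditive.IsIso.comp_right_eq_zero] at hx

theorem op {A B D : C} {i : A ⟶ B} {p : B ⟶ D} (h : IsShortExact i p) :
    IsShortExact p.op i.op :=
  ⟨by rw [← op_comp, h.1, op_zero], h.2.op⟩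

theorem unop {A B D : Cᵒᵖ} {i : A ⟶ B} {p : B ⟶ D} (h : IsShortExact i p) :
    IsShortExact p.unop i.unop :=
  ⟨by rw [← unop_comp, h.1, unop_zero], h.2.unop⟩

theorem iso_comp {A A' B D : C} {i : A ⟶ B} {p : B ⟶ D} (h : IsShortExact i p) (e : A' ≅ A) :
    IsShortExact (e.hom ≫ i) p := by
  simpa using (h.op.comp_iso e.op).unop

theorem biprod_inl_snd (A B : C) : IsShortExact (biprod.inl : A ⟶ A ⊞ B) biprod.snd :=
  of_lift (by simp) fun x hx => ⟨x ≫ biprod.fst, by ext <;> simp [hx]⟩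

theorem biprod_inr_fst (A B : C) : IsShortExact (biprod.inr : B ⟶ A ⊞ B) biprod.fst :=
  of_lift (by simp) fun x hx => ⟨x ≫ biprod.snd, by ext <;> simp [hx]⟩

theorem biprod_map_id {A B D : C} {i : A ⟶ B} {p : B ⟶ D} (h : IsShortExact i p) (X : C) :
    IsShortExact (i ≫ biprod.inl) (biprod.map p (𝟙 X)) := by
  have := h.mono
  have := h.epi
  refine of_lift (by simp [reassoc_of% h.1]) fun x hx => ?_
  obtain ⟨y, hy⟩ := h.exists_lift (x ≫ biprod.fst) (by simpa using hx =≫ biprod.fst)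
  exact ⟨y, by ext <;> simp [hy]; simpa using (hx =≫ biprod.snd).symm⟩

theorem biprod_id_map {A B D : C} {i : A ⟶ B} {p : B ⟶ D} (h : IsShortExact i p) (X : C) :
    IsShortExact (biprod.map (𝟙 X) i) (biprod.snd ≫ p) := by
  have := h.mono
  have := h.epi
  refine of_lift (by simp [h.1]) fun x hx => ?_
  obtain ⟨y, hy⟩ := h.exists_lift (x ≫ biprod.snd) (by simpa using hx)
  exact ⟨biprod.lift (x ≫ biprod.fst) y, by ext <;> simp [hy]⟩

/-- Pulling back a short exact sequence along a morphism to its third term. -/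
theorem exists_of_isPullback {A B D D' P : C} {i : A ⟶ B} {p : B ⟶ D} (h : IsShortExact i p)
    {f : D' ⟶ D} {b' : P ⟶ B} {b : P ⟶ D'} (sq : IsPullback b' b p f) :
    ∃ a : A ⟶ P, IsShortExact a b := by
  have := h.mono
  have := h.epi
  refine ⟨sq.lift i 0 (by simp [h.1]), ?_⟩
  have : Mono (sq.lift i (0 : A ⟶ D') (by simp [h.1])) := mono_of_mono_fac (sq.lift_fst _ _ _)
  have : Epi b := Abelian.epi_snd_of_isLimit p f sq.isLimit
  refine of_lift (by simp) fun x hx => ?_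
  obtain ⟨y, hy⟩ := h.exists_lift (x ≫ b') (by
    rw [Category.assoc, sq.w, reassoc_of% hx, zero_comp])
  exact ⟨y, sq.hom_ext (by simp [hy]) (by simp [hx])⟩

end IsShortExact

/-- `B` is an extension of `D` by `A`: there is a short exact sequence `0 ⟶ A ⟶ B ⟶ D ⟶ 0`. -/
def IsExtension (A B D : C) : Prop :=
  ∃ (i : A ⟶ B) (p : B ⟶ D), IsShortExact i p

namespace IsExtension

theorem _root_.CategoryTheory.ShortComplex.ShortExact.isExtension {S : ShortComplex C}
    (hS : S.ShortExact) : IsExtension S.X₁ S.X₂ S.X₃ :=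
  ⟨S.f, S.g, S.zero, hS⟩

variable {A A' B B' D D' : C}

theorem op (h : IsExtension A B D) : IsExtension (.op D) (.op B : Cᵒᵖ) (.op A) := by
  obtain ⟨i, p, h⟩ := h
  exact ⟨_, _, h.op⟩

theorem unop {A B D : Cᵒᵖ} (h : IsExtension A B D) : IsExtension D.unop B.unop A.unop := by
  obtain ⟨i, p, h⟩ := h
  exact ⟨_, _, h.unop⟩

theorem of_iso_left (h : IsExtension A B D) (e : A' ≅ A) : IsExtension A' B D := by
  obtain ⟨i, p, h⟩ := h
  exact ⟨_, _, h.iso_comp e⟩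

theorem of_iso_right (h : IsExtension A B D) (e : D ≅ D') : IsExtension A B D' := by
  obtain ⟨i, p, h⟩ := h
  exact ⟨_, _, h.comp_iso e⟩

theorem biprod (A B : C) : IsExtension A (A ⊞ B) B :=
  ⟨_, _, IsShortExact.biprod_inl_snd A B⟩

theorem biprod' (A B : C) : IsExtension B (A ⊞ B) A :=
  ⟨_, _, IsShortExact.biprod_inr_fst A B⟩

theorem biprod_right (h : IsExtension A B D) (X : C) : IsExtension A (B ⊞ X) (D ⊞ X) := by
  obtain ⟨i, p, h⟩ := h
  exact ⟨_, _, h.biprod_map_id X⟩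

theorem biprod_left (h : IsExtension A B D) (X : C) : IsExtension (X ⊞ A) (X ⊞ B) D := by
  obtain ⟨i, p, h⟩ := h
  exact ⟨_, _, h.biprod_id_map X⟩

/-- The pullback `P` of two epimorphisms `B ⟶ D` and `B' ⟶ D` is an extension in two ways. -/
theorem exists_pullback (h : IsExtension A B D) (h' : IsExtension A' B' D) :
    ∃ P : C, IsExtension A P B' ∧ IsExtension A' P B := by
  obtain ⟨i, p, h⟩ := h
  obtain ⟨i', p', h'⟩ := h'
  have sq := IsPullback.of_hasPullback p p'
  obtain ⟨a, ha⟩ := h.exists_of_isPullback sq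
  obtain ⟨a', ha'⟩ := h'.exists_of_isPullback sq.flip
  exact ⟨_, ⟨a, _, ha⟩, ⟨a', _, ha'⟩⟩

/-- The preimage `P` in `B` of a subobject `A'` of `D`, when `B` is an extension of `D`. -/
theorem exists_preimage (h : IsExtension A B D) (h' : IsExtension A' D D') :
    ∃ P : C, IsExtension A P A' ∧ IsExtension P B D' := by
  obtain ⟨i, p, h⟩ := h
  obtain ⟨f, q, h'⟩ := h'
  have sq := IsPullback.of_hasPullback p f
  obtain ⟨a, ha⟩ := h.exists_of_isPullback sq
  have := h.epi
  have := h'.mono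
  have := h'.epi
  refine ⟨_, ⟨a, _, ha⟩, pullback.fst p f, p ≫ q, IsShortExact.of_lift ?_ fun x hx => ?_⟩
  · rw [pullback.condition_assoc, h'.1, comp_zero]
  · obtain ⟨y, hy⟩ := h'.exists_lift (x ≫ p) (by simpa using hx)
    exact ⟨pullback.lift x y hy.symm, pullback.lift_fst _ _ _⟩

/-- The pushout `Q` of two monomorphisms `A ⟶ B` and `A ⟶ B'` is an extension in two ways. -/
theorem exists_pushout (h : IsExtension A B D) (h' : IsExtension A B' D') :
    ∃ Q : C, IsExtension B' Q D ∧ IsExtension B Q D' := by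
  obtain ⟨P, h₁, h₂⟩ := h.op.exists_pullback h'.op
  exact ⟨P.unop, h₁.unop, h₂.unop⟩

/-- The quotient `Q` of `B` by a subobject `D'` of `A`, when `A` is a subobject of `B`. -/
theorem exists_quotient (h : IsExtension A B D) (h' : IsExtension D' A A') :
    ∃ Q : C, IsExtension A' Q D ∧ IsExtension D' B Q := by
  obtain ⟨P, h₁, h₂⟩ := h.op.exists_preimage h'.op
  exact ⟨P.unop, h₁.unop, h₂.unop⟩

end IsExtension

/-! ### Vanishing of first extension groups -/

section Ext

variable [HasExt.{u} C]

theorem exists_lift_of_subsingleton_ext {S : ShortComplex C} (hS : S.ShortExact) {X : C}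
    (h : Subsingleton (Ext X S.X₁ 1)) (x : X ⟶ S.X₃) : ∃ y : X ⟶ S.X₂, y ≫ S.g = x := by
  obtain ⟨y, hy⟩ := Ext.covariant_sequence_exact₃ X hS (Ext.mk₀ x) (zero_add 1)
    (Subsingleton.elim _ _)
  obtain ⟨y, rfl⟩ := Ext.mk₀_bijective _ _ |>.surjective y
  exact ⟨y, (Ext.mk₀_bijective _ _).injective (by simpa using hy)⟩

theorem subsingleton_ext_of_exists_lift {S : ShortComplex C} (hS : S.ShortExact) {X : C}
    (h : Subsingleton (Ext X S.X₂ 1)) (hX : ∀ x : X ⟶ S.X₃, ∃ y : X ⟶ S.X₂, y ≫ S.g = x) :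
    Subsingleton (Ext X S.X₁ 1) := by
  refine subsingleton_of_forall_eq 0 fun z => ?_
  obtain ⟨x, rfl⟩ := Ext.covariant_sequence_exact₁ X hS z (Subsingleton.elim _ _) (zero_add 1)
  obtain ⟨x, rfl⟩ := Ext.mk₀_bijective _ _ |>.surjective x
  obtain ⟨y, rfl⟩ := hX x
  rw [← Ext.mk₀_comp_mk₀, Ext.comp_assoc_of_second_deg_zero, hS.comp_extClass, Ext.comp_zero]

theorem exists_desc_of_subsingleton_ext {S : ShortComplex C} (hS : S.ShortExact) {X : C}
    (h : Subsingleton (Ext S.X₃ X 1)) (x : S.X₁ ⟶ X) : ∃ y : S.X₂ ⟶ X, S.f ≫ y = x := by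
  obtain ⟨y, hy⟩ := Ext.contravariant_sequence_exact₁ hS X (Ext.mk₀ x) (add_zero 1)
    (Subsingleton.elim _ _)
  obtain ⟨y, rfl⟩ := Ext.mk₀_bijective _ _ |>.surjective y
  exact ⟨y, (Ext.mk₀_bijective _ _).injective (by simpa using hy)⟩

theorem subsingleton_ext_of_exists_desc {S : ShortComplex C} (hS : S.ShortExact) {X : C}
    (h : Subsingleton (Ext S.X₂ X 1)) (hX : ∀ x : S.X₁ ⟶ X, ∃ y : S.X₂ ⟶ X, S.f ≫ y = x) :
    Subsingleton (Ext S.X₃ X 1) := by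
  refine subsingleton_of_forall_eq 0 fun z => ?_
  obtain ⟨x, rfl⟩ := Ext.contravariant_sequence_exact₃ hS X z (Subsingleton.elim _ _) (add_zero 1)
  obtain ⟨x, rfl⟩ := Ext.mk₀_bijective _ _ |>.surjective x
  obtain ⟨y, rfl⟩ := hX x
  rw [← Ext.mk₀_comp_mk₀, ← Ext.comp_assoc_of_second_deg_zero, hS.extClass_comp, Ext.zero_comp]

namespace IsExtension

variable {A B D X : C}

theorem subsingleton_ext_mid (h : IsExtension A B D) (hA : Subsingleton (Ext X A 1))
    (hD : Subsingleton (Ext X D 1)) : Subsingleton (Ext X B 1) := by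
  obtain ⟨i, p, w, h⟩ := h
  refine subsingleton_of_forall_eq 0 fun z => ?_
  obtain ⟨y, rfl⟩ := Ext.covariant_sequence_exact₂ X h z (hD.elim _ _)
  rw [hA.elim y 0, Ext.zero_comp]

theorem subsingleton_ext_mid' (h : IsExtension A B D) (hA : Subsingleton (Ext A X 1))
    (hD : Subsingleton (Ext D X 1)) : Subsingleton (Ext B X 1) := by
  obtain ⟨i, p, w, h⟩ := h
  refine subsingleton_of_forall_eq 0 fun z => ?_
  obtain ⟨y, rfl⟩ := Ext.contravariant_sequence_exact₂ h X z (hA.elim _ _)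
  rw [hD.elim y 0, Ext.comp_zero]

/-- An extension of `D` by `A` splits if `Ext¹(D, A) = 0`. -/
theorem nonempty_iso_biprod (h : IsExtension A B D) (hDA : Subsingleton (Ext D A 1)) :
    Nonempty (B ≅ A ⊞ D) := by
  obtain ⟨i, p, w, h⟩ := h
  have := h.mono_f
  obtain ⟨s, hs⟩ := exists_lift_of_subsingleton_ext h hDA (𝟙 D)
  exact ⟨(ShortComplex.Splitting.ofExactOfSection _ h.exact s hs h.mono_f).isoBinaryBiproduct⟩

end IsExtension

theorem subsingleton_ext_of_retract {X Y A : C} (r : Retract X Y)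
    (h : Subsingleton (Ext A Y 1)) : Subsingleton (Ext A X 1) := by
  refine subsingleton_of_forall_eq 0 fun z => ?_
  have : (z.comp (Ext.mk₀ r.i) (add_zero 1)).comp (Ext.mk₀ r.r) (add_zero 1) = z := by simp
  rw [← this, h.elim (z.comp _ _) 0, Ext.zero_comp]

theorem subsingleton_ext_of_retract' {X Y A : C} (r : Retract X Y)
    (h : Subsingleton (Ext Y A 1)) : Subsingleton (Ext X A 1) := by
  refine subsingleton_of_forall_eq 0 fun z => ?_
  have : (Ext.mk₀ r.i).comp ((Ext.mk₀ r.r).comp z (zero_add 1)) (zero_add 1) = z := by simp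
  rw [← this, h.elim ((Ext.mk₀ r.r).comp z _) 0, Ext.comp_zero]

end Ext
end Abelian

/-! ### Objects that are Gorenstein relative to a class -/

section Gorenstein

universe v w
variable {C : Type w} [Category.{v} C] [Abelian C] [HasExt.{u} C]

/-- An additive class `W` of objects with `Ext¹(T, T') = 0` for all `T` and `T'` in `W`. -/
structure IsSelfOrthogonal (W : ObjectProperty C) : Prop where
  biprod : ∀ {T T' : C}, W T → W T' → W (T ⊞ T')
  zero : W 0
  ext : ∀ {T T' : C}, W T → W T' → Subsingleton (Ext T T' 1)

/-- A class `P` of objects that is Gorenstein relative to a class `W`: its members are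
`Ext¹`-orthogonal to `W` on both sides, and each of them is a quotient of an object of `W` by a
member of `P` and a subobject of an object of `W` with quotient in `P`. -/
structure IsGorensteinClass (W P : ObjectProperty C) : Prop where
  ext_to : ∀ {G T : C}, P G → W T → Subsingleton (Ext G T 1)
  ext_from : ∀ {G T : C}, P G → W T → Subsingleton (Ext T G 1)
  exists_left : ∀ {G : C}, P G → ∃ K T : C, P K ∧ W T ∧ IsExtension K T G
  exists_right : ∀ {G : C}, P G → ∃ T K : C, W T ∧ P K ∧ IsExtension G T K

/-- The `W`-Gorenstein objects: the largest class of objects that is Gorenstein relative to `W`. -/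
def IsGorenstein (W : ObjectProperty C) : ObjectProperty C :=
  fun G => ∃ P : ObjectProperty C, IsGorensteinClass W P ∧ P G

variable {W : ObjectProperty C}

theorem isGorensteinClass_isGorenstein (W : ObjectProperty C) :
    IsGorensteinClass W (IsGorenstein W) where
  ext_to := fun ⟨_, hP, hG⟩ => hP.ext_to hG
  ext_from := fun ⟨_, hP, hG⟩ => hP.ext_from hG
  exists_left := fun ⟨P, hP, hG⟩ =>
    let ⟨K, T, hK, hT, h⟩ := hP.exists_left hG
    ⟨K, T, ⟨P, hP, hK⟩, hT, h⟩
  exists_right := fun ⟨P, hP, hG⟩ =>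
    let ⟨T, K, hT, hK, h⟩ := hP.exists_right hG
    ⟨T, K, hT, ⟨P, hP, hK⟩, h⟩

namespace IsGorenstein

theorem ext_to {G T : C} (hG : IsGorenstein W G) (hT : W T) : Subsingleton (Ext G T 1) :=
  (isGorensteinClass_isGorenstein W).ext_to hG hT

theorem ext_from {G T : C} (hG : IsGorenstein W G) (hT : W T) : Subsingleton (Ext T G 1) :=
  (isGorensteinClass_isGorenstein W).ext_from hG hT

theorem exists_left {G : C} (hG : IsGorenstein W G) :
    ∃ K T : C, IsGorenstein W K ∧ W T ∧ IsExtension K T G :=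
  (isGorensteinClass_isGorenstein W).exists_left hG

theorem exists_right {G : C} (hG : IsGorenstein W G) :
    ∃ T K : C, W T ∧ IsGorenstein W K ∧ IsExtension G T K :=
  (isGorensteinClass_isGorenstein W).exists_right hG

theorem of_iso {G G' : C} (hG : IsGorenstein W G) (e : G ≅ G') : IsGorenstein W G' := by
  refine ⟨fun X => ∃ Y, IsGorenstein W Y ∧ Nonempty (Y ≅ X), ⟨?_, ?_, ?_, ?_⟩, G, hG, ⟨e⟩⟩
  · rintro X T ⟨Y, hY, ⟨e⟩⟩ hT
    exact subsingleton_ext_of_retract' e.symm.retract (hY.ext_to hT)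
  · rintro X T ⟨Y, hY, ⟨e⟩⟩ hT
    exact subsingleton_ext_of_retract e.symm.retract (hY.ext_from hT)
  · rintro X ⟨Y, hY, ⟨e⟩⟩
    obtain ⟨K, T, hK, hT, h⟩ := hY.exists_left
    exact ⟨K, T, ⟨K, hK, ⟨.refl K⟩⟩, hT, h.of_iso_right e⟩
  · rintro X ⟨Y, hY, ⟨e⟩⟩
    obtain ⟨T, K, hT, hK, h⟩ := hY.exists_right
    exact ⟨T, K, hT, ⟨K, hK, ⟨.refl K⟩⟩, h.of_iso_left e.symm⟩

/-- The relative horseshoe lemma, which needs only that `Ext¹(T, A) = 0` and `Ext¹(D, T) = 0`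
for `T` in `W`. -/
theorem of_isExtension (hW : IsSelfOrthogonal W) {A B D : C} (h : IsExtension A B D)
    (hA : IsGorenstein W A) (hD : IsGorenstein W D) : IsGorenstein W B := by
  refine ⟨fun X => ∃ A D, IsExtension A X D ∧ IsGorenstein W A ∧ IsGorenstein W D,
    ⟨?_, ?_, ?_, ?_⟩, A, D, h, hA, hD⟩
  · rintro X T ⟨A, D, h, hA, hD⟩ hT
    exact h.subsingleton_ext_mid' (hA.ext_to hT) (hD.ext_to hT)
  · rintro X T ⟨A, D, h, hA, hD⟩ hT
    exact h.subsingleton_ext_mid (hA.ext_from hT) (hD.ext_from hT)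
  · rintro X ⟨A, D, h, hA, hD⟩
    obtain ⟨K₁, T₁, hK₁, hT₁, h₁⟩ := hA.exists_left
    obtain ⟨K₃, T₃, hK₃, hT₃, h₃⟩ := hD.exists_left
    -- The pullback of `X` and `T₃` over `D` splits as `A ⊞ T₃`, hence is a quotient of `T₁ ⊞ T₃`.
    obtain ⟨P, hP, hP'⟩ := h.exists_pullback h₃
    obtain ⟨e⟩ := hP.nonempty_iso_biprod (hA.ext_from hT₃)
    obtain ⟨K, hK, hK'⟩ := ((h₁.biprod_right T₃).of_iso_right e.symm).exists_preimage hP'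
    exact ⟨K, _, ⟨K₁, K₃, hK, hK₁, hK₃⟩, hW.biprod hT₁ hT₃, hK'⟩
  · rintro X ⟨A, D, h, hA, hD⟩
    obtain ⟨T₁, K₁, hT₁, hK₁, h₁⟩ := hA.exists_right
    obtain ⟨T₃, K₃, hT₃, hK₃, h₃⟩ := hD.exists_right
    obtain ⟨Q, hQ, hQ'⟩ := h.exists_pushout h₁
    obtain ⟨e⟩ := hQ.nonempty_iso_biprod (hD.ext_to hT₁)
    obtain ⟨K, hK, hK'⟩ := ((h₃.biprod_left T₁).of_iso_left e).exists_quotient hQ'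
    exact ⟨_, K, hW.biprod hT₁ hT₃, ⟨K₁, K₃, hK, hK₁, hK₃⟩, hK'⟩

theorem of_mem (hW : IsSelfOrthogonal W) {T : C} (hT : W T) : IsGorenstein W T := by
  have hid (T : C) : IsExtension 0 T T := ⟨0, 𝟙 T, .of_lift (by simp) fun x hx =>
    ⟨0, by simpa using hx.symm⟩⟩
  refine ⟨W, ⟨hW.ext, fun hG hT => hW.ext hT hG, fun {G} hG => ?_, fun {G} hG => ?_⟩, hT⟩
  · exact ⟨0, G, hW.zero, hG, hid G⟩
  · refine ⟨G, 0, hG, hW.zero, 𝟙 G, 0, .of_lift (by simp) fun x _ => ⟨x, by simp⟩⟩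

/-- A direct summand `G` of a Gorenstein object is Gorenstein if its complement `T` is in `W`: for
`0 ⟶ K ⟶ T' ⟶ G ⊞ T ⟶ 0` the kernel of `T' ⟶ G` is an extension of `T` by `K`, and dually. -/
theorem of_biprod (hW : IsSelfOrthogonal W) {G T : C} (hT : W T)
    (hG : IsGorenstein W (G ⊞ T)) : IsGorenstein W G := by
  refine ⟨fun X => ∃ T, W T ∧ IsGorenstein W (X ⊞ T), ⟨?_, ?_, ?_, ?_⟩, T, hT, hG⟩
  · rintro X T' ⟨T, hT, hX⟩ hT'
    exact subsingleton_ext_of_retract' ⟨biprod.inl, biprod.fst, biprod.inl_fst⟩ (hX.ext_to hT')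
  · rintro X T' ⟨T, hT, hX⟩ hT'
    exact subsingleton_ext_of_retract ⟨biprod.inl, biprod.fst, biprod.inl_fst⟩ (hX.ext_from hT')
  all_goals
    rintro X ⟨T, hT, hX⟩
    have hT' := of_mem hW hT
  · obtain ⟨K, T', hK, hT'', h⟩ := hX.exists_left
    obtain ⟨P, hP, hP'⟩ := h.exists_preimage (.biprod' X T)
    exact ⟨P, T', ⟨T, hT, of_isExtension hW (.biprod P T) (of_isExtension hW hP hK hT') hT'⟩,
      hT'', hP'⟩
  · obtain ⟨T', K, hT'', hK, h⟩ := hX.exists_right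
    obtain ⟨Q, hQ, hQ'⟩ := h.exists_quotient (.biprod X T)
    exact ⟨T', Q, hT'', ⟨T, hT, of_isExtension hW (.biprod Q T)
      (of_isExtension hW hQ hT' hK) hT'⟩, hQ'⟩

/-- The pullback of `B` along an epimorphism from `T` in `W` onto `D` is Gorenstein, and it
splits as `A ⊞ T`. -/
theorem of_isExtension_left (hW : IsSelfOrthogonal W) {A B D : C} (h : IsExtension A B D)
    (hA : ∀ {T : C}, W T → Subsingleton (Ext T A 1)) (hB : IsGorenstein W B)
    (hD : IsGorenstein W D) : IsGorenstein W A := by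
  obtain ⟨K, T, hK, hT, h'⟩ := hD.exists_left
  obtain ⟨P, hP, hP'⟩ := h.exists_pullback h'
  obtain ⟨e⟩ := hP.nonempty_iso_biprod (hA hT)
  exact of_biprod hW hT ((of_isExtension hW hP' hK hB).of_iso e)

/-- The pushout of `B` along a monomorphism of `A` into `T` in `W` is Gorenstein, and it
splits as `T ⊞ D`. -/
theorem of_isExtension_right (hW : IsSelfOrthogonal W) {A B D : C} (h : IsExtension A B D)
    (hA : IsGorenstein W A) (hB : IsGorenstein W B)
    (hD : ∀ {T : C}, W T → Subsingleton (Ext D T 1)) :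
    IsGorenstein W D := by
  obtain ⟨T, K, hT, hK, h'⟩ := hA.exists_right
  obtain ⟨Q, hQ, hQ'⟩ := h.exists_pushout h'
  obtain ⟨e⟩ := hQ.nonempty_iso_biprod (hD hT)
  exact of_biprod hW hT
    ((of_isExtension hW hQ' hB hK).of_iso (e ≪≫ biprod.braiding T D))

end IsGorenstein

end Gorenstein

/-! ### Functoriality of the tensor product in the left module -/

section BalancedTensor

variable (R : Type u) [Ring R]

namespace BalancedTensor

variable {A B M N : Type u} [AddCommGroup A] [Module Rᵐᵒᵖ A] [AddCommGroup B] [Module Rᵐᵒᵖ B]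
  [AddCommGroup M] [Module R M] [AddCommGroup N] [Module R N]

/-- The element `a ⊗ m` of `A ⊗_R M`. -/
def tmul (a : A) (m : M) : BalancedTensor R A M :=
  QuotientAddGroup.mk (a ⊗ₜ[ℤ] m)

theorem addHom_ext {X : Type*} [AddCommGroup X] {f g : BalancedTensor R A M →+ X}
    (h : ∀ (a : A) (m : M), f (tmul R a m) = g (tmul R a m)) : f = g := by
  refine QuotientAddGroup.addMonoidHom_ext _ (AddMonoidHom.ext fun x => ?_)
  induction x using TensorProduct.induction_on with
  | zero => simp
  | tmul a m => exact h a m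
  | add x y hx hy => rw [map_add, map_add, hx, hy]

variable (A) in
/-- The homomorphism `A ⊗_R g : A ⊗_R M → A ⊗_R N` induced by a homomorphism `g : M → N` of left
`R`-modules. -/
def mapRight (g : M →ₗ[R] N) : BalancedTensor R A M →+ BalancedTensor R A N :=
  QuotientAddGroup.map _ _ (g.toAddMonoidHom.toIntLinearMap.lTensor A).toAddMonoidHom <| by
    refine (AddSubgroup.closure_le _).2 ?_
    rintro _ ⟨a, r, m, rfl⟩
    refine AddSubgroup.subset_closure ⟨a, r, g m, ?_⟩
    simp

theorem mapRight_tmul (g : M →ₗ[R] N) (a : A) (m : M) :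
    mapRight R A g (tmul R a m) = tmul R a (g m) :=
  rfl

theorem tmul_add (a : A) (m m' : M) : tmul R a (m + m') = tmul R a m + tmul R a m' :=
  congrArg QuotientAddGroup.mk (TensorProduct.tmul_add a m m')

theorem mapRight_map (f : A →ₗ[Rᵐᵒᵖ] B) (g : M →ₗ[R] N) (x : BalancedTensor R A M) :
    mapRight R B g (BalancedTensor.map R M f x) = BalancedTensor.map R N f (mapRight R A g x) :=
  DFunLike.congr_fun (f := (mapRight R B g).comp (BalancedTensor.map R M f))
    (g := (BalancedTensor.map R N f).comp (mapRight R A g)) (addHom_ext R fun _ _ => rfl) x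

/-- If `M` is the direct sum of `N` and `N'` with projections `p`, `p'` and inclusions `i`, `i'`,
then an element of `A ⊗_R M` is the sum of its components in `A ⊗_R N` and `A ⊗_R N'`. -/
theorem mapRight_comp_add_mapRight_comp {N' : Type u} [AddCommGroup N'] [Module R N']
    (p : M →ₗ[R] N) (i : N →ₗ[R] M) (p' : M →ₗ[R] N') (i' : N' →ₗ[R] M)
    (h : ∀ m, i (p m) + i' (p' m) = m) (x : BalancedTensor R A M) :
    mapRight R A i (mapRight R A p x) + mapRight R A i' (mapRight R A p' x) = x :=
  DFunLike.congr_fun (f := (mapRight R A i).comp (mapRight R A p) +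
    (mapRight R A i').comp (mapRight R A p')) (g := AddMonoidHom.id _)
    (addHom_ext R fun a m => by simp [mapRight_tmul, ← tmul_add, h]) x

end BalancedTensor

end BalancedTensor

/-! ### Flat-cotorsion modules form an additive self-orthogonal class -/

section FlatCotorsion

variable {R : Type u} [Ring R]

open BalancedTensor

theorem IsFlat.biprod {M N : ModuleCat.{u} R} (hM : IsFlat M) (hN : IsFlat N) :
    IsFlat (M ⊞ N) := by
  intro A B _ _ _ _ f hf
  refine (injective_iff_map_eq_zero _).2 fun x hx => ?_
  have h₁ := (injective_iff_map_eq_zero _).1 (hM A B f hf)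
    (mapRight R A (biprod.fst : M ⊞ N ⟶ M).hom x) (by rw [← mapRight_map, hx, map_zero])
  have h₂ := (injective_iff_map_eq_zero _).1 (hN A B f hf)
    (mapRight R A (biprod.snd : M ⊞ N ⟶ N).hom x) (by rw [← mapRight_map, hx, map_zero])
  rw [← mapRight_comp_add_mapRight_comp R (biprod.fst : M ⊞ N ⟶ M).hom
    (biprod.inl : M ⟶ M ⊞ N).hom
    (biprod.snd : M ⊞ N ⟶ N).hom (biprod.inr : N ⟶ M ⊞ N).hom
    (fun m => ConcreteCategory.congr_hom (biprod.total (X := M) (Y := N)) m) x, h₁, h₂]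
  simp

theorem isFlat_zero : IsFlat (0 : ModuleCat.{u} R) := by
  have := ModuleCat.subsingleton_of_isZero (isZero_zero (ModuleCat.{u} R))
  intro A B _ _ _ _ f hf
  have h : AddMonoidHom.id (BalancedTensor R A (0 : ModuleCat.{u} R)) = 0 :=
    addHom_ext R fun a m => by
      rw [Subsingleton.elim m 0]
      exact congrArg QuotientAddGroup.mk (TensorProduct.tmul_zero _ a)
  exact fun x y _ => (DFunLike.congr_fun h x).trans (DFunLike.congr_fun h y).symm

/-- The class of flat-cotorsion modules. -/
def flatCotorsion (R : Type u) [Ring R] : ObjectProperty (ModuleCat.{u} R) :=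
  fun T => IsFlatCotorsion T

theorem isSelfOrthogonal_flatCotorsion : IsSelfOrthogonal (flatCotorsion R) where
  biprod hT hT' := ⟨hT.1.biprod hT'.1, fun F hF =>
    (IsExtension.biprod _ _).subsingleton_ext_mid (hT.2 F hF) (hT'.2 F hF)⟩
  zero := ⟨isFlat_zero, fun F _ => by
    refine subsingleton_of_forall_eq 0 fun z => ?_
    rw [← z.comp_mk₀_id, (isZero_zero (ModuleCat.{u} R)).eq_of_src (𝟙 0) 0, Ext.mk₀_zero,
      Ext.comp_zero]⟩
  ext hT hT' := hT'.2 _ hT.1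

end FlatCotorsion

/-! ### Acyclicity in terms of morphisms -/

section Complex

theorem acyclic_iff_of_chainComplex {D : Type*} [Category* D] [Abelian D]
    (T : ChainComplex D ℤ) :
    T.Acyclic ↔ ∀ n : ℤ, (T.sc' (n + 1 + 1) (n + 1) n).Exact := by
  have h (n : ℤ) : T.ExactAt (n + 1) ↔ (T.sc' (n + 1 + 1) (n + 1) n).Exact :=
    T.exactAt_iff' _ _ _ (by simp) (by simp)
  refine ⟨fun hT n => (h n).1 (hT _), fun hT n => ?_⟩
  obtain ⟨n, rfl⟩ : ∃ m, n = m + 1 := ⟨n - 1, by simp⟩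
  exact (h n).2 (hT n)

variable {R : Type u} [Ring R]

/-- `Hom(W, T)` is acyclic if and only if every map from `W` that is killed by the differential of
`T` lifts along the preceding differential. -/
theorem homFrom_acyclic_iff (W : ModuleCat.{u} R) (T : ChainComplex (ModuleCat.{u} R) ℤ) :
    (homFrom W T).Acyclic ↔ ∀ (n : ℤ) (x : W ⟶ T.X (n + 1)), x ≫ T.d (n + 1) n = 0 →
      ∃ y : W ⟶ T.X (n + 1 + 1), y ≫ T.d (n + 1 + 1) (n + 1) = x := by
  rw [acyclic_iff_of_chainComplex]
  exact forall_congr' fun n => ShortComplex.ab_exact_iff _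

/-- `Hom(T, W)` is acyclic if and only if every map from a term of `T` to `W` that vanishes on
boundaries factors through the differential starting at that term. -/
theorem homInto_acyclic_iff (T : ChainComplex (ModuleCat.{u} R) ℤ) (W : ModuleCat.{u} R) :
    (homInto T W).Acyclic ↔ ∀ (n : ℤ) (x : T.X (n + 1) ⟶ W), T.d (n + 1 + 1) (n + 1) ≫ x = 0 →
      ∃ y : T.X n ⟶ W, T.d (n + 1) n ≫ y = x := by
  have h (n : ℤ) : (homInto T W).ExactAt (n + 1) ↔
      ∀ x : T.X (n + 1) ⟶ W, T.d (n + 1 + 1) (n + 1) ≫ x = 0 →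
        ∃ y : T.X n ⟶ W, T.d (n + 1) n ≫ y = x := by
    rw [(homInto T W).exactAt_iff' n (n + 1) (n + 1 + 1)
      ((ComplexShape.down ℤ).symm.prev_eq' rfl) ((ComplexShape.down ℤ).symm.next_eq' rfl)]
    exact ShortComplex.ab_exact_iff _
  refine ⟨fun hT n => (h n).1 (hT _), fun hT n => ?_⟩
  obtain ⟨n, rfl⟩ : ∃ m, n = m + 1 := ⟨n - 1, by simp⟩
  exact (h n).2 (hT n)

end Complex

/-! ### Cycles of totally acyclic complexes -/

section Cycles

variable {R : Type u} [Ring R]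

theorem isShortExact_iCycles_toCycles {T : ChainComplex (ModuleCat.{u} R) ℤ} (hT : T.Acyclic)
    (n : ℤ) : IsShortExact (T.iCycles (n + 1)) (T.toCycles (n + 1) n) := by
  have : Epi (T.toCycles (n + 1) n) := by
    have h := (T.exactAt_iff_isZero_homology n).1 (hT n)
    have := T.homologyIsCokernel (n + 1) n (by simp)
    exact Preadditive.epi_of_isZero_cokernel' _ this h
  refine .of_lift (by simp [← cancel_mono (T.iCycles n)]) fun x hx => ?_
  exact ⟨T.liftCycles x n (by simp) (by rw [← T.toCycles_i, reassoc_of% hx, zero_comp]), by simp⟩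

/-- Exactness of `Hom(W, T)` lifts maps from `W` to the cycles of `T` to the terms of `T`, and
exactness of `Hom(T, W)` extends maps from the cycles to `W` to the terms; since the terms are
cotorsion and flat, this gives the two `Ext¹` conditions. The cycles themselves need not be known
to be cotorsion. -/
theorem IsTotallyAcyclic.isGorensteinClass {T : ChainComplex (ModuleCat.{u} R) ℤ}
    (hT : IsTotallyAcyclic T) :
    IsGorensteinClass (GorFlatCot.flatCotorsion R) fun G => ∃ n : ℤ, G = T.cycles n where
  ext_to := by
    rintro _ W ⟨n, rfl⟩ hW
    obtain ⟨w, h⟩ := isShortExact_iCycles_toCycles hT.acyclic n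
    refine subsingleton_ext_of_exists_desc h (hW.2 _ (hT.flatCotorsion _).1) fun x => ?_
    obtain ⟨y, hy⟩ := (homInto_acyclic_iff T W).1 (hT.homInto_acyclic W hW) (n + 1)
      (T.toCycles (n + 1 + 1) (n + 1) ≫ x) (by simp)
    have := (isShortExact_iCycles_toCycles hT.acyclic (n + 1)).epi
    exact ⟨y, by rw [← cancel_epi (T.toCycles (n + 1 + 1) (n + 1)), ← hy]; simp⟩
  ext_from := by
    rintro _ W ⟨n, rfl⟩ hW
    obtain ⟨n, rfl⟩ : ∃ m, n = m + 1 + 1 := ⟨n - 1 - 1, by simp⟩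
    obtain ⟨w, h⟩ := isShortExact_iCycles_toCycles hT.acyclic (n + 1)
    refine subsingleton_ext_of_exists_lift h ((hT.flatCotorsion _).2 _ hW.1) fun x => ?_
    obtain ⟨y, hy⟩ := (homFrom_acyclic_iff W T).1 (hT.homFrom_acyclic W hW) n
      (x ≫ T.iCycles (n + 1)) (by simp)
    exact ⟨y, by rw [← cancel_mono (T.iCycles (n + 1)), ← hy]; simp⟩
  exists_left := by
    rintro _ ⟨n, rfl⟩
    exact ⟨_, _, ⟨n + 1, rfl⟩, hT.flatCotorsion _, _, _,
      isShortExact_iCycles_toCycles hT.acyclic n⟩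
  exists_right := by
    rintro _ ⟨n, rfl⟩
    obtain ⟨n, rfl⟩ : ∃ m, n = m + 1 := ⟨n - 1, by simp⟩
    exact ⟨_, _, hT.flatCotorsion _, ⟨n, rfl⟩, _, _,
      isShortExact_iCycles_toCycles hT.acyclic n⟩

theorem IsGorensteinFlatCotorsion.isGorenstein {G : ModuleCat.{u} R}
    (hG : IsGorensteinFlatCotorsion G) : IsGorenstein (flatCotorsion R) G := by
  obtain ⟨T, hT, ⟨e⟩⟩ := hG
  exact .of_iso ⟨_, hT.isGorensteinClass, 0, rfl⟩ e

end Cycles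

/-! ### Splicing short exact sequences -/

section Splice

/-- A relation for which every element has a predecessor and a successor has doubly infinite
chains through any given element. -/
theorem exists_int_sequence {α : Type*} {r : α → α → Prop} (hl : ∀ x, ∃ y, r y x)
    (hr : ∀ x, ∃ y, r x y) (a : α) : ∃ Z : ℤ → α, Z 0 = a ∧ ∀ n, r (Z (n + 1)) (Z n) := by
  choose l hl using hl
  choose s hr using hr
  refine ⟨fun n => Int.casesOn n (fun k => l^[k] a) fun k => s^[k + 1] a, rfl, fun n => ?_⟩
  cases n with
  | ofNat k =>
    change r (l^[k + 1] a) (l^[k] a)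
    rw [Function.iterate_succ_apply']
    exact hl _
  | negSucc k =>
    cases k with
    | zero => exact hr a
    | succ k =>
      change r (s^[k + 1] a) (s^[k + 1 + 1] a)
      rw [Function.iterate_succ_apply' s (k + 1)]
      exact hr _

variable {D : Type*} [Category* D] [Abelian D]

/-- Short exact sequences `0 ⟶ Z (n + 1) ⟶ X n ⟶ Z n ⟶ 0` splice to a complex with terms `X n`
and differentials `X (n + 1) ⟶ Z (n + 1) ⟶ X n`. -/
theorem exists_splice {Z X : ℤ → D}
    (h : ∀ n, IsExtension (Z (n + 1)) (X n) (Z n)) :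
    ∃ (T : ChainComplex D ℤ) (i : ∀ n, Z (n + 1) ⟶ T.X n) (p : ∀ n, T.X n ⟶ Z n),
      (∀ n, T.X n = X n) ∧ (∀ n, IsShortExact (i n) (p n)) ∧
        ∀ n, T.d (n + 1) n = p (n + 1) ≫ i n := by
  choose i p h using h
  exact ⟨ChainComplex.of X (fun n => p (n + 1) ≫ i n) fun n => by simp [reassoc_of% (h (n + 1)).1],
    i, p, fun _ => rfl, h, fun n => ChainComplex.of_d X (fun n => p (n + 1) ≫ i n) n⟩

variable {T : ChainComplex D ℤ} {Z : ℤ → D} {i : ∀ n, Z (n + 1) ⟶ T.X n}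
  {p : ∀ n, T.X n ⟶ Z n}

theorem comp_splice_d (h : ∀ n, IsShortExact (i n) (p n))
    (hd : ∀ n, T.d (n + 1) n = p (n + 1) ≫ i n) (n : ℤ) : i (n + 1) ≫ T.d (n + 1) n = 0 := by
  rw [hd, reassoc_of% (h (n + 1)).1, zero_comp]

/-- `Z (n + 2)` is the kernel of the differential `X (n + 1) ⟶ X n` of a spliced complex. -/
noncomputable def isLimitSpliceKernelFork (h : ∀ n, IsShortExact (i n) (p n))
    (hd : ∀ n, T.d (n + 1) n = p (n + 1) ≫ i n) (n : ℤ) :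
    IsLimit (KernelFork.ofι (f := T.d (n + 1) n) (i (n + 1)) (comp_splice_d h hd n)) :=
  have := (h (n + 1)).mono
  have := (h n).mono
  KernelFork.IsLimit.ofι' _ _ fun x hx =>
    have hx' : x ≫ p (n + 1) = 0 := by
      rw [← cancel_mono (i n), zero_comp, Category.assoc, ← hd, hx]
    ⟨((h (n + 1)).exists_lift x hx').choose, ((h (n + 1)).exists_lift x hx').choose_spec⟩

theorem splice_acyclic (h : ∀ n, IsShortExact (i n) (p n))
    (hd : ∀ n, T.d (n + 1) n = p (n + 1) ≫ i n) : T.Acyclic := by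
  refine (acyclic_iff_of_chainComplex _).2 fun n => ?_
  have := (h (n + 1 + 1)).epi
  let S : ShortComplex D := .mk _ _ (comp_splice_d h hd n)
  have hS : S.Exact := S.exact_of_f_is_kernel (isLimitSpliceKernelFork h hd n)
  let φ : T.sc' (n + 1 + 1) (n + 1) n ⟶ S :=
    { τ₁ := p (n + 1 + 1)
      τ₂ := 𝟙 (T.X (n + 1))
      τ₃ := 𝟙 (T.X n)
      comm₁₂ := (hd (n + 1)).symm.trans (Category.comp_id _).symm
      comm₂₃ := (Category.id_comp (T.d (n + 1) n)).trans (Category.comp_id _).symm }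
  have : Epi φ.τ₁ := this
  have : IsIso φ.τ₂ := inferInstanceAs (IsIso (𝟙 _))
  have : Mono φ.τ₃ := inferInstanceAs (Mono (𝟙 _))
  exact (ShortComplex.exact_iff_of_epi_of_isIso_of_mono φ).2 hS

theorem nonempty_splice_cycles_iso (h : ∀ n, IsShortExact (i n) (p n))
    (hd : ∀ n, T.d (n + 1) n = p (n + 1) ≫ i n) (n : ℤ) :
    Nonempty (T.cycles n ≅ Z (n + 1)) := by
  obtain ⟨n, rfl⟩ : ∃ m, n = m + 1 := ⟨n - 1, by simp⟩
  exact ⟨(T.cyclesIsKernel (n + 1) n (by simp)).conePointUniqueUpToIso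
    (isLimitSpliceKernelFork h hd n)⟩

end Splice

/-! ### Gorenstein flat-cotorsion modules as relative Gorenstein objects -/

section Main

variable {R : Type u} [Ring R]

/-- A map from `W` into a cycle `Z (n + 2)` lifts to `X (n + 2)` because `Ext¹(W, Z (n + 3)) = 0`,
and a map from `Z (n + 1)` to `W` extends to `X n` because `Ext¹(Z n, W) = 0`. -/
theorem isTotallyAcyclic_splice {T : ChainComplex (ModuleCat.{u} R) ℤ} {Z : ℤ → ModuleCat.{u} R}
    {i : ∀ n, Z (n + 1) ⟶ T.X n} {p : ∀ n, T.X n ⟶ Z n} (h : ∀ n, IsShortExact (i n) (p n))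
    (hd : ∀ n, T.d (n + 1) n = p (n + 1) ≫ i n) (hT : ∀ n, IsFlatCotorsion (T.X n))
    (hZ : ∀ n, IsGorenstein (flatCotorsion R) (Z n)) : IsTotallyAcyclic T where
  flatCotorsion := hT
  acyclic := splice_acyclic h hd
  homInto_acyclic W hW := (homInto_acyclic_iff _ _).2 fun n x hx => by
    have := (h (n + 1 + 1)).epi
    rw [hd, Category.assoc, ← comp_zero (f := p (n + 1 + 1)), cancel_epi] at hx
    have := (h (n + 1)).epi
    obtain ⟨w, hex⟩ := h (n + 1)
    obtain ⟨w', hex'⟩ := h n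
    obtain ⟨y, hy⟩ := exists_desc_of_subsingleton_ext hex' ((hZ n).ext_to hW) (hex.exact.desc x hx)
    refine ⟨y, ?_⟩
    rw [hd, Category.assoc, hy]
    exact hex.exact.g_desc x hx
  homFrom_acyclic W hW := (homFrom_acyclic_iff _ _).2 fun n x hx => by
    have := (h n).mono
    rw [hd, ← Category.assoc, ← zero_comp (f := i n), cancel_mono] at hx
    obtain ⟨z, rfl⟩ := (h (n + 1)).exists_lift x hx
    obtain ⟨w, hex⟩ := h (n + 1 + 1)
    obtain ⟨y, rfl⟩ := exists_lift_of_subsingleton_ext hex ((hZ _).ext_from hW) z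
    exact ⟨y, by rw [hd, Category.assoc]⟩

/-- The Gorenstein flat-cotorsion modules are the Gorenstein objects relative to the class of
flat-cotorsion modules. -/
theorem isGorensteinFlatCotorsion_iff (G : ModuleCat.{u} R) :
    IsGorensteinFlatCotorsion G ↔ IsGorenstein (flatCotorsion R) G := by
  refine ⟨IsGorensteinFlatCotorsion.isGorenstein, fun hG => ?_⟩
  obtain ⟨Z, hZ₀, hZ⟩ := exists_int_sequence
    (α := {G : ModuleCat.{u} R // IsGorenstein (flatCotorsion R) G})
    (r := fun A B => ∃ T, IsFlatCotorsion T ∧ IsExtension A.1 T B.1)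
    (fun A => let ⟨K, T, hK, hT, h⟩ := A.2.exists_left; ⟨⟨K, hK⟩, T, hT, h⟩)
    (fun A => let ⟨T, K, hT, hK, h⟩ := A.2.exists_right; ⟨⟨K, hK⟩, T, hT, h⟩) ⟨G, hG⟩
  -- The cycles of the spliced complex in degree `0` are the term of index `1`.
  obtain ⟨Z, rfl, hZ⟩ : ∃ Z : ℤ → {G : ModuleCat.{u} R // IsGorenstein (flatCotorsion R) G},
      (Z (0 + 1)).1 = G ∧ ∀ n, ∃ T, IsFlatCotorsion T ∧ IsExtension (Z (n + 1)).1 T (Z n).1 :=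
    ⟨fun n => Z (n - 1), by simp [hZ₀], fun n => by
      simpa [sub_add_cancel, add_sub_cancel_right] using hZ (n - 1)⟩
  choose X hX h using hZ
  obtain ⟨T, i, p, hT, h, hd⟩ := exists_splice (Z := fun n => (Z n).1) h
  exact ⟨T, isTotallyAcyclic_splice h hd (fun n => hT n ▸ hX n) fun n => (Z n).2,
    nonempty_splice_cycles_iso h hd 0⟩

end Main

end GorFlatCot

theorem mainTheorem10 {R : Type u} [Ring R]
    (S : ShortComplex (ModuleCat.{u} R)) (hS : S.ShortExact)
    (h₁ : GorFlatCot.IsCotorsion S.X₁) (h₂ : GorFlatCot.IsCotorsion S.X₂)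
    (h₃ : GorFlatCot.IsCotorsion S.X₃) :
    (GorFlatCot.IsGorensteinFlatCotorsion S.X₃ →
      (GorFlatCot.IsGorensteinFlatCotorsion S.X₂ ↔
        GorFlatCot.IsGorensteinFlatCotorsion S.X₁)) ∧
    (GorFlatCot.IsGorensteinFlatCotorsion S.X₁ →
      GorFlatCot.IsGorensteinFlatCotorsion S.X₂ →
      (GorFlatCot.IsGorensteinFlatCotorsion S.X₃ ↔
        ∀ W : ModuleCat.{u} R, GorFlatCot.IsFlatCotorsion W →
          Subsingleton (Ext S.X₃ W 1))) := by
  have hW := GorFlatCot.isSelfOrthogonal_flatCotorsion (R := R)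
  simp only [GorFlatCot.isGorensteinFlatCotorsion_iff]
  refine ⟨fun hX₃ => ⟨fun hX₂ => ?_, fun hX₁ => ?_⟩,
    fun hX₁ hX₂ => ⟨fun hX₃ W hW => ?_, fun h => ?_⟩⟩
  · exact .of_isExtension_left hW hS.isExtension (fun hT => h₁ _ hT.1) hX₂ hX₃
  · exact .of_isExtension hW hS.isExtension hX₁ hX₃
  · exact hX₃.ext_to hW
  · exact .of_isExtension_right hW hS.isExtension hX₁ hX₂ (h _)
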